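/- Let $\hbar>0$ and let $\mu_A,\mu_B$ be probability measures on $\mathbb R$ (momentum-kick distributions), with dephasing functions $g_j(\xi)=\int e^{ip\xi/\hbar}\,d\mu_j(p)$, $j\in\{A,B\}$. Let $X$ be the position operator (multiplication by $x$) on $L^2(\mathbb R)$. A state on a Hilbert space is a positive trace-class operator of trace one. For a state $\rho$ on $L^2(\mathbb R)$ put $$\Delta_{g_j}(\rho)=\int e^{ipX/\hbar}\,\rho\,e^{-ipX/\hbar}\,d\mu_j(p),$$ (so the kernel $\rho(x,y)$ is mapped to $g_j(x-y)\rho(x,y)$), and for a state $\rho$ on $L^2(\mathbb R)\otimes L^2(\mathbb R)$ put $$(\Delta_{g_A}\otimes\Delta_{g_B})(\rho)=\iint \big(e^{ipX/\hbar}\otimes e^{iqX/\hbar}\big)\,\rho\,\big(e^{-ipX/\hbar}\otimes e^{-iqX/\hbar}\big)\,d\mu_A(p)\,d\mu_B(q).$$ For states $\rho,\sigma$ let $S(\rho\Vert\sigma)=\operatorname{Tr}\rho(\ln\rho-\ln\sigma)\in[0,\infty]$ be the quantum relative entropy, defined in general from the spectral decompositions $\rho=\sum_p pP_p$, $\sigma=\sum_q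 qQ_q$ by $S(\rho\Vert\sigma)=\sum_{p,q}\operatorname{Tr}(P_pQ_qP_p)\,(p\ln p-p\ln q+q-p)$, where the scalar factor is $q$ if $p=0$ and $\infty$ if $p>0=q$, and $0\cdot\infty=0$. Define the relative-entropy and Hilbert--Schmidt losses $$C_{\rm rel}^{g_j}(\rho)=S(\rho\Vert\Delta_{g_j}(\rho)),\qquad C_2^{g_j}(\rho)=\operatorname{Tr}(\rho^2)-\operatorname{Tr}(\Delta_{g_j}(\rho)^2),$$ and $C_{\rm rel}^{g_A,g_B}$, $C_2^{g_A,g_B}$ in the same way with $\Delta_{g_A}\otimes\Delta_{g_B}$ in place of $\Delta_{g_j}$. (1) For all states $\rho_A,\rho_B$ on $L^2(\mathbb R)$: $\rho_A\otimes\rho_B$, $\Delta_{g_A}(\rho_A)$ and $\Delta_{g_B}(\rho_B)$ are states, $(\Delta_{g_A}\otimes\Delta_{g_B})(\rho_A\otimes\rho_B)=\Delta_{g_A}(\rho_A)\otimes\Delta_{g_B}(\rho_B)$, the relative-entropy loss is additive, $$C_{\rm rel}^{g_A,g_B}(\rho_A\otimes\rho_B)=C_{\rm rel}^{g_A}(\rho_A)+C_{\rm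 rel}^{g_B}(\rho_B)\quad\text{in }[0,\infty]$$ (in particular the left side is finite if and only if both terms on the right are), and $$C_2^{g_A,g_B}(\rho_A\otimes\rho_B)=\operatorname{Tr}(\rho_A^2)\operatorname{Tr}(\rho_B^2)-\operatorname{Tr}\big(\Delta_{g_A}(\rho_A)^2\big)\operatorname{Tr}\big(\Delta_{g_B}(\rho_B)^2\big).$$ (2) The Hilbert--Schmidt loss is not additive: if $|g_A(\xi)|<1$ for some $\xi$ and $|g_B(\xi)|<1$ for some $\xi$, then there are states $\rho_A,\rho_B$ on $L^2(\mathbb R)$ with $C_2^{g_A,g_B}(\rho_A\otimes\rho_B)\neq C_2^{g_A}(\rho_A)+C_2^{g_B}(\rho_B)$. -/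

import Mathlib

open MeasureTheory Complex
open scoped ENNReal NNReal TensorProduct InnerProductSpace

noncomputable section

namespace Dephasing

section Hilbert

variable {H : Type*} [NormedAddCommGroup H] [InnerProductSpace ℂ H] [CompleteSpace H]

/-- The trace `∑ᵢ ⟪eᵢ, T eᵢ⟫ ∈ [0, ∞]` of a positive bounded operator, computed in a Hilbert basis.
By `posTrace_eq_tsum` it does not depend on the basis. -/
def posTrace (T : H →L[ℂ] H) : ℝ≥0∞ :=
  ∑' i, ENNReal.ofReal
    (⟪(exists_hilbertBasis ℂ H).choose_spec.choose i,
      T ((exists_hilbertBasis ℂ H).choose_spec.choose i)⟫_ℂ).re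

theorem tsum_inner_sq_eq {ι : Type*} (b : HilbertBasis ι ℂ H) (x : H) :
    ∑' i, ENNReal.ofReal (‖⟪b i, x⟫_ℂ‖ ^ 2) = ENNReal.ofReal (‖x‖ ^ 2) := by
  have h := b.hasSum_inner_mul_inner x x
  have h2 : HasSum (fun i => ‖⟪b i, x⟫_ℂ‖ ^ 2) (‖x‖ ^ 2) := by
    have h3 := (Complex.hasSum_re h)
    convert h3 using 1
    · funext i
      rw [← inner_conj_symm x (b i), ← Complex.normSq_eq_conj_mul_self, Complex.ofReal_re,
        Complex.normSq_eq_norm_sq]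
    · exact (inner_self_eq_norm_sq (𝕜 := ℂ) x).symm
  rw [← ENNReal.ofReal_tsum_of_nonneg (fun i => by positivity) h2.summable, h2.tsum_eq]

theorem tsum_norm_sq_adjoint {ι κ : Type*} (b : HilbertBasis ι ℂ H) (c : HilbertBasis κ ℂ H)
    (S : H →L[ℂ] H) :
    ∑' i, ENNReal.ofReal (‖S (b i)‖ ^ 2)
      = ∑' j, ENNReal.ofReal (‖ContinuousLinearMap.adjoint S (c j)‖ ^ 2) :=
  calc _ = ∑' i, ∑' j, ENNReal.ofReal (‖⟪c j, S (b i)⟫_ℂ‖ ^ 2) := by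
        simp_rw [tsum_inner_sq_eq c]
    _ = ∑' j, ∑' i, ENNReal.ofReal (‖⟪c j, S (b i)⟫_ℂ‖ ^ 2) := ENNReal.tsum_comm
    _ = _ := by
        refine tsum_congr fun j => ?_
        rw [← tsum_inner_sq_eq b]
        refine tsum_congr fun i => ?_
        rw [ContinuousLinearMap.adjoint_inner_right, norm_inner_symm]

theorem tsum_posTrace_aux {ι κ : Type*} (b : HilbertBasis ι ℂ H) (c : HilbertBasis κ ℂ H)
    {T : H →L[ℂ] H} (hT : T.IsPositive) :
    ∑' i, ENNReal.ofReal (⟪b i, T (b i)⟫_ℂ).re = ∑' j, ENNReal.ofReal (⟪c j, T (c j)⟫_ℂ).re := by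
  obtain ⟨S, rfl⟩ := CStarAlgebra.nonneg_iff_eq_star_mul_self.mp
    ((ContinuousLinearMap.nonneg_iff_isPositive T).mpr hT)
  have key : ∀ x : H, (⟪x, (star S * S) x⟫_ℂ).re = ‖S x‖ ^ 2 := fun x => by
    rw [ContinuousLinearMap.star_eq_adjoint, mul_apply_eq_comp,
      ContinuousLinearMap.adjoint_inner_right]
    exact inner_self_eq_norm_sq (𝕜 := ℂ) (S x)
  simp_rw [key]
  rw [tsum_norm_sq_adjoint b c S, tsum_norm_sq_adjoint c c S]

/-- The trace of a positive operator may be computed in any Hilbert basis. -/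
theorem posTrace_eq_tsum {ι : Type*} (b : HilbertBasis ι ℂ H) {T : H →L[ℂ] H}
    (hT : T.IsPositive) :
    posTrace T = ∑' i, ENNReal.ofReal (⟪b i, T (b i)⟫_ℂ).re :=
  tsum_posTrace_aux _ b hT

/-- A (normal) state: a positive trace-class operator of trace one. -/
structure IsDensityOperator (ρ : H →L[ℂ] H) : Prop where
  isPositive : ρ.IsPositive
  posTrace_eq_one : posTrace ρ = 1

/-- `Tr(T²)` for a self-adjoint operator `T`; finite when `T` is a state. -/
def purity (T : H →L[ℂ] H) : ℝ := (posTrace (T * T)).toReal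

/-- The orthogonal projection onto the eigenspace of `T` for the real number `a`
(zero if `a` is not an eigenvalue). -/
def eigenProj (T : H →L[ℂ] H) (a : ℝ≥0) : H →L[ℂ] H :=
  (T - ((a : ℝ) : ℂ) • (1 : H →L[ℂ] H)).ker.starProjection

/-- The scalar function `p log p - p log q + q - p ∈ [0, ∞]`, with its usual values
`q` at `p = 0` and `∞` at `p > 0 = q`. -/
def scalarRelEntropy (p q : ℝ≥0) : ℝ≥0∞ :=
  if p = 0 then q
  else if q = 0 then ∞
  else ENNReal.ofReal (p * Real.log p - p * Real.log q + q - p)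

/-- Umegaki's quantum relative entropy `S(ρ‖σ) = Tr ρ (log ρ - log σ) ∈ [0, ∞]` of two states on a
Hilbert space of arbitrary dimension, in Lindblad's form: with the spectral decompositions
`ρ = ∑ p P_p` and `σ = ∑ q Q_q`,
`S(ρ‖σ) = ∑_{p,q} Tr(P_p Q_q P_p) (p log p - p log q + q - p)`.
All terms are nonnegative, the terms `q - p` add up to `Tr σ - Tr ρ = 0`, and the value is `∞` as
soon as the support of `ρ` is not contained in that of `σ`. -/
def relEntropy (ρ σ : H →L[ℂ] H) : ℝ≥0∞ :=
  ∑' (p : ℝ≥0) (q : ℝ≥0),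
    posTrace (eigenProj ρ p * eigenProj σ q * eigenProj ρ p) * scalarRelEntropy p q

end Hilbert

section Tensor

variable (H K : Type*) [NormedAddCommGroup H] [InnerProductSpace ℂ H]
  [NormedAddCommGroup K] [InnerProductSpace ℂ K]

/-- The Hilbert space tensor product: the completion of the algebraic tensor product for the inner
product `⟪x ⊗ y, x' ⊗ y'⟫ = ⟪x, x'⟫ ⟪y, y'⟫`. -/
abbrev HilbertTensor : Type _ := UniformSpace.Completion (H ⊗[ℂ] K)

variable {H K}

/-- The bounded operator `A ⊗ B` on the Hilbert space tensor product. -/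
def opTensor (A : H →L[ℂ] H) (B : K →L[ℂ] K) : HilbertTensor H K →L[ℂ] HilbertTensor H K :=
  (TensorProduct.mapL A B).completion

theorem opTensor_tmul (A : H →L[ℂ] H) (B : K →L[ℂ] K) (x : H) (y : K) :
    opTensor A B ((x ⊗ₜ[ℂ] y : H ⊗[ℂ] K) : HilbertTensor H K)
      = ((A x ⊗ₜ[ℂ] B y : H ⊗[ℂ] K) : HilbertTensor H K) := by
  simp [opTensor]

end Tensor

/-- The Hilbert space `L²(ℝ)` of a particle on the line, in the position representation. -/
abbrev L2R : Type := Lp ℂ 2 (volume : Measure ℝ)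

/-- The phase `x ↦ e^{i p x / ħ}`. -/
def phase (ħ p : ℝ) (x : ℝ) : ℂ := Complex.exp (Complex.I * (p * x / ħ : ℝ))

theorem norm_phase (ħ p x : ℝ) : ‖phase ħ p x‖ = 1 := by
  rw [phase, mul_comm]; exact Complex.norm_exp_ofReal_mul_I _

theorem continuous_phase (ħ p : ℝ) : Continuous (phase ħ p) := by
  unfold phase; fun_prop

theorem memLp_phase (ħ p : ℝ) : MemLp (phase ħ p) ∞ (volume : Measure ℝ) :=
  memLp_top_of_bound (continuous_phase ħ p).aestronglyMeasurable 1
    (Filter.Eventually.of_forall fun x => (norm_phase ħ p x).le)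

/-- The momentum kick `e^{i p X / ħ}` on `L²(ℝ)`: multiplication by `x ↦ e^{i p x / ħ}`. -/
def kick (ħ p : ℝ) : L2R →L[ℂ] L2R :=
  (ContinuousLinearMap.mul ℂ ℂ).holderL (volume : Measure ℝ) ∞ 2 2 (memLp_phase ħ p).toLp

theorem coeFn_kick (ħ p : ℝ) (ψ : L2R) :
    (kick ħ p ψ : ℝ → ℂ) =ᵐ[volume] fun x => phase ħ p x * ψ x := by
  have h := (ContinuousLinearMap.mul ℂ ℂ).coeFn_holder (r := 2) ((memLp_phase ħ p).toLp) ψ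
  filter_upwards [h, (memLp_phase ħ p).coeFn_toLp] with x hx hx'
  rw [← hx', ← ContinuousLinearMap.mul_apply' ℂ ℂ, ← hx]
  rfl

/-- The dephasing function `g(ξ) = ∫ e^{i p ξ / ħ} dμ(p)`, the characteristic function of the kick
distribution `μ`. -/
def dephasingFun (ħ : ℝ) (μ : Measure ℝ) (ξ : ℝ) : ℂ := ∫ p, phase ħ p ξ ∂μ

/-- The random momentum kick (position dephasing) channel
`Δ_g(ρ) = ∫ e^{i p X / ħ} ρ e^{-i p X / ħ} dμ(p)`, for `ρ` trace class (so that the integrand is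
norm continuous); on kernels it multiplies `ρ(x, y)` by `g(x - y)`. -/
def dephase (ħ : ℝ) (μ : Measure ℝ) (ρ : L2R →L[ℂ] L2R) : L2R →L[ℂ] L2R :=
  ∫ p, kick ħ p * ρ * kick ħ (-p) ∂μ

/-- The product channel `Δ_{g_A} ⊗ Δ_{g_B}` on `L²(ℝ) ⊗ L²(ℝ)`: independent random momentum kicks
of the two particles, with distributions `μA` and `μB`. -/
def dephaseProd (ħ : ℝ) (μA μB : Measure ℝ)
    (ρ : HilbertTensor L2R L2R →L[ℂ] HilbertTensor L2R L2R) :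
    HilbertTensor L2R L2R →L[ℂ] HilbertTensor L2R L2R :=
  ∫ pq : ℝ × ℝ, opTensor (kick ħ pq.1) (kick ħ pq.2) * ρ *
    opTensor (kick ħ (-pq.1)) (kick ħ (-pq.2)) ∂(μA.prod μB)

/-- The relative-entropy loss `S(ρ‖Δ(ρ)) ∈ [0, ∞]` of a map `Δ` on operators. -/
def relEntropyLoss {H : Type*} [NormedAddCommGroup H] [InnerProductSpace ℂ H] [CompleteSpace H]
    (Δ : (H →L[ℂ] H) → (H →L[ℂ] H)) (ρ : H →L[ℂ] H) : ℝ≥0∞ :=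
  relEntropy ρ (Δ ρ)

/-- The Hilbert-Schmidt loss `Tr(ρ²) - Tr(Δ(ρ)²)` of a map `Δ` on operators. -/
def hilbertSchmidtLoss {H : Type*} [NormedAddCommGroup H] [InnerProductSpace ℂ H]
    [CompleteSpace H] (Δ : (H →L[ℂ] H) → (H →L[ℂ] H)) (ρ : H →L[ℂ] H) : ℝ :=
  purity ρ - purity (Δ ρ)

end Dephasing

end

open Dephasing

/-! A product state kicked independently in each factor stays a product, because $(U_p\otimes
U_q)(\rho_A\otimes\rho_B)(U_p\otimes U_q)^*$ is bilinear in the two conjugated factors and Fubini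
applies (`dephaseProd_opTensor`). Part (1) then reduces to tensor products of states. Trace and
purity multiply there (`posTrace_opTensor`, `purity_opTensor`).

For additivity of relative entropy (`relEntropy_opTensor`), eigenbases $b_i$, $c_k$ of $\rho$,
$\sigma$ turn Lindblad's formula into a sum of scalar relative entropies with weights $|\langle
c_k,b_i\rangle|^2$ (`relEntropy_eq_tsum`). This sum does not see multiplicities, which matters
because distinct pairs of eigenvalues may have the same product. The weights are doubly stochastic,
and they multiply under tensor products. A scalar identity without subtraction
(`scalarRelEntropy_mul`) is summed against them in $[0,\infty]$; its linear terms all sum to $1$ and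
cancel, so infinite entropies need no separate treatment.

For part (2), take the same pure state with nowhere vanishing wave function in both factors. If
$a,b$ are the purities after dephasing, the defect of additivity is $-(1-a)(1-b)$. Purity $1$ would
give the dephased state an eigenvector of eigenvalue $1$; equality in Cauchy-Schwarz then makes
almost all kicked wave functions proportional to it, so $\mu$ is a point mass and $|g|=1$ everywhere
(`purity_dephase_ne_one`). -/

noncomputable section

namespace Dephasing

/-! ### Compactness and diagonalization of positive operators of finite trace. -/

section Spectral

variable {H : Type*} [NormedAddCommGroup H] [InnerProductSpace ℂ H]

/-- Cauchy-Schwarz on the coefficients, then Bessel's inequality. With square-summable columns, this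
makes the rank-one expansion converge in operator norm. -/
theorem norm_sum_rankOne_le {ι : Type*} {v : ι → H} (hv : Orthonormal ℂ v) (w : ι → H)
    (s : Finset ι) :
    ‖∑ i ∈ s, InnerProductSpace.rankOne ℂ (w i) (v i)‖ ≤ √(∑ i ∈ s, ‖w i‖ ^ 2) := by
  refine ContinuousLinearMap.opNorm_le_bound _ (Real.sqrt_nonneg _) fun x => ?_
  rw [sum_apply]
  simp only [InnerProductSpace.rankOne_apply]
  calc ‖∑ i ∈ s, ⟪v i, x⟫_ℂ • w i‖ ≤ ∑ i ∈ s, ‖⟪v i, x⟫_ℂ‖ * ‖w i‖ := by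
        refine (norm_sum_le _ _).trans (Finset.sum_le_sum fun i _ => ?_)
        rw [norm_smul]
    _ ≤ √(∑ i ∈ s, ‖⟪v i, x⟫_ℂ‖ ^ 2) * √(∑ i ∈ s, ‖w i‖ ^ 2) :=
        Real.sum_mul_le_sqrt_mul_sqrt _ _ _
    _ ≤ ‖x‖ * √(∑ i ∈ s, ‖w i‖ ^ 2) := by
        gcongr
        exact Real.sqrt_le_iff.mpr ⟨norm_nonneg x, hv.sum_inner_products_le x⟩
    _ = _ := mul_comm _ _

theorem isCompactOperator_rankOne (x y : H) :
    IsCompactOperator (InnerProductSpace.rankOne ℂ x y : H →L[ℂ] H) := by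
  have hid : IsCompactOperator (id : ℂ → ℂ) :=
    (isCompactOperator_id_iff_finiteDimensional (𝕜 := ℂ)).mpr inferInstance
  have h := (hid.comp_clm (InnerProductSpace.rankOne ℂ (1 : ℂ) y)).clm_comp
    (ContinuousLinearMap.toSpanSingleton ℂ x)
  convert! h using 1
  funext z
  simp

variable [CompleteSpace H]

theorem exists_re_inner_eq_norm_sq {T : H →L[ℂ] H} (hT : T.IsPositive) :
    ∃ S : H →L[ℂ] H, T = ContinuousLinearMap.adjoint S * S ∧
      ∀ x, (⟪x, T x⟫_ℂ).re = ‖S x‖ ^ 2 := by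
  obtain ⟨S, rfl⟩ := CStarAlgebra.nonneg_iff_eq_star_mul_self.mp
    ((ContinuousLinearMap.nonneg_iff_isPositive T).mpr hT)
  refine ⟨S, by rw [ContinuousLinearMap.star_eq_adjoint], fun x => ?_⟩
  rw [ContinuousLinearMap.star_eq_adjoint, mul_apply_eq_comp,
    ContinuousLinearMap.adjoint_inner_right]
  exact inner_self_eq_norm_sq (𝕜 := ℂ) (S x)

theorem summable_norm_sq_of_posTrace_ne_top {ι : Type*} (b : HilbertBasis ι ℂ H)
    {T : H →L[ℂ] H} (hT : T.IsPositive) (htr : posTrace T ≠ ∞) :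
    Summable fun i => ‖T (b i)‖ ^ 2 := by
  obtain ⟨S, hS, hin⟩ := exists_re_inner_eq_norm_sq hT
  rw [posTrace_eq_tsum b hT] at htr
  simp_rw [hin] at htr
  have h1 : Summable fun i => ‖S (b i)‖ ^ 2 := by
    have h := ENNReal.summable_toReal htr
    refine h.congr fun i => ?_
    rw [ENNReal.toReal_ofReal (by positivity)]
  refine Summable.of_nonneg_of_le (fun i => by positivity) (fun i => ?_)
    (h1.mul_left (‖ContinuousLinearMap.adjoint S‖ ^ 2))
  rw [hS, ← mul_pow]
  gcongr
  exact (ContinuousLinearMap.adjoint S).le_opNorm (S (b i))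

/-- A positive operator of finite trace is the norm convergent sum of the rank-one operators given
by its columns in any Hilbert basis. -/
theorem hasSum_rankOne_of_posTrace_ne_top {ι : Type*} (b : HilbertBasis ι ℂ H)
    {T : H →L[ℂ] H} (hT : T.IsPositive) (htr : posTrace T ≠ ∞) :
    HasSum (fun i => InnerProductSpace.rankOne ℂ (T (b i)) (b i)) T := by
  have hs := summable_norm_sq_of_posTrace_ne_top b hT htr
  have hsum : Summable fun i => InnerProductSpace.rankOne ℂ (T (b i)) (b i) := by
    rw [summable_iff_vanishing_norm] at hs ⊢
    intro ε hε
    obtain ⟨s, hs⟩ := hs (ε ^ 2) (by positivity)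
    refine ⟨s, fun t ht => (norm_sum_rankOne_le b.orthonormal _ t).trans_lt ?_⟩
    rw [Real.sqrt_lt' hε]
    exact (le_abs_self _).trans_lt (hs t ht)
  convert! hsum.hasSum
  ext x
  have h1 := ((b.hasSum_repr x).mapL T)
  have h2 := hsum.hasSum.mapL (ContinuousLinearMap.apply ℂ H x)
  refine h1.unique ?_
  convert! h2 using 1
  funext i
  simp [b.repr_apply_apply]

theorem isCompactOperator_of_posTrace_ne_top {T : H →L[ℂ] H} (hT : T.IsPositive)
    (htr : posTrace T ≠ ∞) : IsCompactOperator T := by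
  obtain ⟨w, b, -⟩ := exists_hilbertBasis ℂ H
  refine isCompactOperator_of_tendsto (hasSum_rankOne_of_posTrace_ne_top b hT htr)
    (Filter.Eventually.of_forall fun s => ?_)
  exact (compactOperator (RingHom.id ℂ) H H).sum_mem fun i _ => isCompactOperator_rankOne _ _

/-- Diagonalization: a positive operator of finite trace has a Hilbert basis of eigenvectors, with
nonnegative eigenvalues. -/
theorem exists_eigenbasis.{u} {H : Type u} [NormedAddCommGroup H] [InnerProductSpace ℂ H]
    [CompleteSpace H] {T : H →L[ℂ] H} (hT : T.IsPositive) (htr : posTrace T ≠ ∞) :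
    ∃ (ι : Type u) (b : HilbertBasis ι ℂ H) (p : ι → ℝ≥0),
      ∀ i, T (b i) = ((p i : ℝ) : ℂ) • b i := by
  have hE : ∀ μ : ℂ, IsClosed (Module.End.eigenspace (T : Module.End ℂ H) μ : Set H) := fun μ => by
    have : (Module.End.eigenspace (T : Module.End ℂ H) μ : Set H)
        = {x | T x = μ • x} := by
      ext x; simp
    rw [this]
    exact isClosed_eq T.continuous (continuous_const_smul μ)
  have : ∀ μ : ℂ, CompleteSpace (Module.End.eigenspace (T : Module.End ℂ H) μ) :=
    fun μ => (hE μ).completeSpace_coe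
  -- Letting `μ` range over all of `ℂ` is harmless: a trivial eigenspace has an empty basis.
  choose w b hb using fun μ : ℂ => exists_hilbertBasis ℂ
    (Module.End.eigenspace (T : Module.End ℂ H) μ)
  have hv := hT.isSymmetric.orthogonalFamily_eigenspaces.orthonormal_sigma_orthonormal
    (fun μ => (b μ).orthonormal)
  have hperp : (Submodule.span ℂ (Set.range fun a : (μ : ℂ) × w μ =>
      (Module.End.eigenspace (T : Module.End ℂ H) a.1).subtypeₗᵢ (b a.1 a.2)))ᗮ = ⊥ := by
    rw [eq_bot_iff, ← ContinuousLinearMap.orthogonalComplement_iSup_eigenspaces_eq_bot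
      (isCompactOperator_of_posTrace_ne_top hT htr) hT.isSymmetric, ← Submodule.iInf_orthogonal]
    refine le_iInf fun μ x hx => ?_
    rw [Submodule.mem_orthogonal]
    intro u hu
    have h := ((b μ).hasSum_repr ⟨u, hu⟩).mapL
      ((innerSL ℂ x) ∘L (Module.End.eigenspace (T : Module.End ℂ H) μ).subtypeL)
    have h0 : ∀ i, ((innerSL ℂ x) ∘L (Module.End.eigenspace (T : Module.End ℂ H) μ).subtypeL)
        ((b μ).repr ⟨u, hu⟩ i • b μ i) = 0 := fun i => by
      have h3 := (Submodule.mem_orthogonal' _ _).mp hx _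
        (Submodule.subset_span ⟨(⟨μ, i⟩ : (μ : ℂ) × w μ), rfl⟩)
      rw [map_smul]
      simp only [ContinuousLinearMap.comp_apply, innerSL_apply_apply]
      erw [h3]
      simp
    simp_rw [h0] at h
    have h4 := h.unique hasSum_zero
    rw [inner_eq_zero_symm]
    exact h4
  refine ⟨_, HilbertBasis.mkOfOrthogonalEqBot hv hperp, fun a => ‖a.1‖₊, fun a => ?_⟩
  rw [HilbertBasis.coe_mkOfOrthogonalEqBot]
  have hmem : T (b a.1 a.2 : H) = a.1 • (b a.1 a.2 : H) :=
    Module.End.mem_eigenspace_iff.mp (b a.1 a.2).2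
  have hn : ⟪(b a.1 a.2 : H), (b a.1 a.2 : H)⟫_ℂ = 1 := by
    have := (b a.1).orthonormal.1 a.2
    rw [inner_self_eq_norm_sq_to_K]
    rw [Submodule.norm_coe, this]; simp
  -- Positivity puts the eigenvalue `a.1` on the nonnegative half-line, so it equals its own norm.
  have hpos := hT.inner_nonneg_right (b a.1 a.2 : H)
  rw [hmem, inner_smul_right, hn, mul_one] at hpos
  rw [coe_nnnorm, ← Complex.eq_coe_norm_of_nonneg hpos]
  exact hmem

end Spectral

/-! ### Relative entropy and purity in eigenbases. -/

section Entropy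

variable {H : Type*} [NormedAddCommGroup H] [InnerProductSpace ℂ H] [CompleteSpace H]

theorem eigenProj_apply_eigenvector {T : H →L[ℂ] H} (hT : T.IsPositive) {x : H} {p : ℝ≥0}
    (hx : T x = ((p : ℝ) : ℂ) • x) (a : ℝ≥0) :
    eigenProj T a x = if p = a then x else 0 := by
  unfold eigenProj
  split_ifs with h
  · subst h
    rw [Submodule.starProjection_eq_self_iff]
    simp [LinearMap.mem_ker, hx]
  · rw [Submodule.starProjection_apply_eq_zero_iff, Submodule.mem_orthogonal]
    intro u hu
    have hu' : T u = ((a : ℝ) : ℂ) • u := by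
      simpa [LinearMap.mem_ker, sub_eq_zero] using hu
    have h1 := hT.inner_left_eq_inner_right u x
    rw [hu', hx, inner_smul_left, inner_smul_right, Complex.conj_ofReal] at h1
    have h2 : (((a : ℝ) : ℂ) - ((p : ℝ) : ℂ)) * ⟪u, x⟫_ℂ = 0 := by rw [sub_mul, h1, sub_self]
    refine (mul_eq_zero.mp h2).resolve_left fun h3 => h ?_
    rw [sub_eq_zero] at h3
    exact_mod_cast h3.symm

theorem inner_eigenProj_left (T : H →L[ℂ] H) (a : ℝ≥0) (x y : H) :
    ⟪eigenProj T a x, y⟫_ℂ = ⟪x, eigenProj T a y⟫_ℂ :=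
  Submodule.inner_starProjection_left_eq_right _ _ _

theorem isPositive_eigenProj (T : H →L[ℂ] H) (a : ℝ≥0) : (eigenProj T a).IsPositive :=
  ContinuousLinearMap.IsPositive.of_isStarProjection isStarProjection_starProjection

theorem re_inner_eigenProj_self (T : H →L[ℂ] H) (a : ℝ≥0) (x : H) :
    (⟪x, eigenProj T a x⟫_ℂ).re = ‖eigenProj T a x‖ ^ 2 := by
  have h : eigenProj T a (eigenProj T a x) = eigenProj T a x :=
    Submodule.starProjection_eq_self_iff.mpr (Submodule.starProjection_apply_mem _ _)
  rw [← h, ← inner_eigenProj_left, h]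
  exact inner_self_eq_norm_sq (𝕜 := ℂ) _

/-- In the eigenbasis `b` the outer projections act as indicators, leaving `‖Q_t b_i‖²`, which
Parseval expands in the eigenbasis `c`. -/
theorem posTrace_eigenProj_mul {ι κ : Type*} {ρ σ : H →L[ℂ] H} (hρ : ρ.IsPositive)
    (hσ : σ.IsPositive) (b : HilbertBasis ι ℂ H) (c : HilbertBasis κ ℂ H) {p : ι → ℝ≥0}
    {q : κ → ℝ≥0} (hb : ∀ i, ρ (b i) = ((p i : ℝ) : ℂ) • b i)
    (hc : ∀ k, σ (c k) = ((q k : ℝ) : ℂ) • c k) (s t : ℝ≥0) :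
    posTrace (eigenProj ρ s * eigenProj σ t * eigenProj ρ s) =
      ∑' i, ∑' k, if p i = s then if q k = t then ENNReal.ofReal (‖⟪c k, b i⟫_ℂ‖ ^ 2) else 0
        else 0 := by
  have hpos : (eigenProj ρ s * eigenProj σ t * eigenProj ρ s).IsPositive := by
    have := (isPositive_eigenProj σ t).conj_starProjection
      (ρ - ((s : ℝ) : ℂ) • (1 : H →L[ℂ] H)).ker
    rwa [mul_assoc]
  rw [posTrace_eq_tsum b hpos]
  refine tsum_congr fun i => ?_
  rw [mul_apply_eq_comp, mul_apply_eq_comp, ← inner_eigenProj_left,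
    eigenProj_apply_eigenvector hρ (hb i)]
  split_ifs with h
  · rw [re_inner_eigenProj_self, ← tsum_inner_sq_eq c]
    refine tsum_congr fun k => ?_
    rw [← inner_eigenProj_left, eigenProj_apply_eigenvector hσ (hc k)]
    split_ifs <;> simp
  · simp

/-- The relative entropy in terms of eigenbases of the two operators. -/
theorem relEntropy_eq_tsum {ι κ : Type*} {ρ σ : H →L[ℂ] H} (hρ : ρ.IsPositive)
    (hσ : σ.IsPositive) (b : HilbertBasis ι ℂ H) (c : HilbertBasis κ ℂ H) {p : ι → ℝ≥0}
    {q : κ → ℝ≥0} (hb : ∀ i, ρ (b i) = ((p i : ℝ) : ℂ) • b i)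
    (hc : ∀ k, σ (c k) = ((q k : ℝ) : ℂ) • c k) :
    relEntropy ρ σ =
      ∑' i, ∑' k, ENNReal.ofReal (‖⟪c k, b i⟫_ℂ‖ ^ 2) * scalarRelEntropy (p i) (q k) := by
  unfold relEntropy
  simp_rw [posTrace_eigenProj_mul hρ hσ b c hb hc, ← ENNReal.tsum_mul_right]
  calc _ = ∑' s : ℝ≥0, ∑' i, ∑' t : ℝ≥0, ∑' k, (if p i = s then if q k = t then
        ENNReal.ofReal (‖⟪c k, b i⟫_ℂ‖ ^ 2) else 0 else 0) * scalarRelEntropy s t :=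
        tsum_congr fun s => ENNReal.tsum_comm
    _ = ∑' i, ∑' s : ℝ≥0, ∑' t : ℝ≥0, ∑' k, (if p i = s then if q k = t then
        ENNReal.ofReal (‖⟪c k, b i⟫_ℂ‖ ^ 2) else 0 else 0) * scalarRelEntropy s t :=
        ENNReal.tsum_comm
    _ = _ := by
        refine tsum_congr fun i => ?_
        -- For fixed `i` and `k` only `s = p i`, `t = q k` contributes, so the sums over all real
        -- `s`, `t` collapse.
        rw [tsum_eq_single (p i) fun s hs => by simp [hs.symm], ENNReal.tsum_comm]
        refine tsum_congr fun k => ?_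
        rw [tsum_eq_single (q k) fun t ht => by simp [ht.symm]]
        simp

theorem posTrace_eq_tsum_eigenvalues {ι : Type*} {T : H →L[ℂ] H} (hT : T.IsPositive)
    (b : HilbertBasis ι ℂ H) {p : ι → ℝ≥0} (hb : ∀ i, T (b i) = ((p i : ℝ) : ℂ) • b i) :
    posTrace T = ∑' i, (p i : ℝ≥0∞) := by
  rw [posTrace_eq_tsum b hT]
  refine tsum_congr fun i => ?_
  have h : ⟪b i, b i⟫_ℂ = 1 := by
    rw [inner_self_eq_norm_sq_to_K, b.orthonormal.1 i]; simp
  rw [hb, inner_smul_right, h, mul_one, Complex.ofReal_re, ENNReal.ofReal_coe_nnreal]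

theorem isPositive_mul_self {T : H →L[ℂ] H} (hT : T.IsPositive) : (T * T).IsPositive := by
  have h := ContinuousLinearMap.isPositive_adjoint_comp_self T
  rwa [hT.isSelfAdjoint.adjoint_eq] at h

theorem posTrace_mul_self_eq_tsum_eigenvalues {ι : Type*} {T : H →L[ℂ] H} (hT : T.IsPositive)
    (b : HilbertBasis ι ℂ H) {p : ι → ℝ≥0} (hb : ∀ i, T (b i) = ((p i : ℝ) : ℂ) • b i) :
    posTrace (T * T) = ∑' i, (p i : ℝ≥0∞) ^ 2 := by
  have h : ∀ i, (T * T) (b i) = ((p i ^ 2 : ℝ≥0) : ℝ) • b i := fun i => by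
    rw [mul_apply_eq_comp, hb, map_smul, hb, smul_smul]
    push_cast
    rw [pow_two, ← Complex.coe_smul]
    push_cast
    rfl
  rw [posTrace_eq_tsum_eigenvalues (isPositive_mul_self hT) b h]
  simp

/-- A state of purity one has the eigenvalue one. -/
theorem exists_eigenvector_one_of_purity_eq_one {T : H →L[ℂ] H} (hT : IsDensityOperator T)
    (h : purity T = 1) : ∃ x : H, ‖x‖ = 1 ∧ T x = x := by
  have htr := hT.posTrace_eq_one
  obtain ⟨ι, b, p, hb⟩ := exists_eigenbasis hT.isPositive (by rw [htr]; simp)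
  rw [posTrace_eq_tsum_eigenvalues hT.isPositive b hb] at htr
  rw [purity, ENNReal.toReal_eq_one_iff,
    posTrace_mul_self_eq_tsum_eigenvalues hT.isPositive b hb] at h
  have hle : ∀ i, (p i : ℝ≥0∞) ≤ 1 := fun i => htr ▸ ENNReal.le_tsum i
  obtain ⟨i, hi⟩ : ∃ i, (p i : ℝ≥0∞) ≠ 0 := by
    by_contra! h0
    simp [h0] at htr
  refine ⟨b i, b.orthonormal.1 i, ?_⟩
  suffices hp : (p i : ℝ≥0∞) = 1 by
    have : p i = 1 := by exact_mod_cast hp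
    rw [hb, this]; simp
  by_contra hne
  have hlt : (p i : ℝ≥0∞) ^ 2 < p i := by
    rw [pow_two]
    conv_rhs => rw [← one_mul (p i : ℝ≥0∞)]
    exact ENNReal.mul_lt_mul_left hi (by simp) (lt_of_le_of_ne (hle i) hne)
  -- Since `p² ≤ p` termwise, one strict inequality would separate `∑ p²` from `∑ p`, but both are
  -- `1`.
  have := ENNReal.tsum_lt_tsum (f := fun i => (p i : ℝ≥0∞) ^ 2) (g := fun i => (p i : ℝ≥0∞))
    (by rw [h]; simp) (fun j => by
      rw [pow_two]; exact mul_le_of_le_one_left' (hle j)) hlt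
  rw [h, htr] at this
  exact lt_irrefl _ this

theorem posTrace_rankOne_self (x : H) (hx : ‖x‖ = 1) :
    posTrace (InnerProductSpace.rankOne ℂ x x) = 1 := by
  obtain ⟨w, b, -⟩ := exists_hilbertBasis ℂ H
  rw [posTrace_eq_tsum b (InnerProductSpace.isPositive_rankOne_self x)]
  have h := tsum_inner_sq_eq b x
  rw [hx] at h
  convert h using 1
  · refine tsum_congr fun i => ?_
    rw [InnerProductSpace.rankOne_apply, inner_smul_right, ← inner_conj_symm, mul_comm,
      Complex.mul_conj, Complex.normSq_eq_norm_sq, Complex.ofReal_re]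
  · simp

theorem isDensityOperator_rankOne_self {x : H} (hx : ‖x‖ = 1) :
    IsDensityOperator (InnerProductSpace.rankOne ℂ x x) :=
  ⟨InnerProductSpace.isPositive_rankOne_self x, posTrace_rankOne_self x hx⟩

theorem purity_rankOne_self {x : H} (hx : ‖x‖ = 1) :
    purity (InnerProductSpace.rankOne ℂ x x) = 1 := by
  rw [purity, (InnerProductSpace.isIdempotentElem_rankOne_self hx).eq, posTrace_rankOne_self x hx,
    ENNReal.toReal_one]

/-- This and its primed companion say that the overlaps of two Hilbert bases form a doubly
stochastic matrix. -/
theorem tsum_eigenvalues_mul_inner_sq {ι κ : Type*} (b : HilbertBasis ι ℂ H)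
    (c : HilbertBasis κ ℂ H) (p : ι → ℝ≥0∞) :
    ∑' i, ∑' k, ENNReal.ofReal (‖⟪c k, b i⟫_ℂ‖ ^ 2) * p i = ∑' i, p i := by
  refine tsum_congr fun i => ?_
  rw [ENNReal.tsum_mul_right, tsum_inner_sq_eq, b.orthonormal.1 i]
  simp

theorem tsum_eigenvalues_mul_inner_sq' {ι κ : Type*} (b : HilbertBasis ι ℂ H)
    (c : HilbertBasis κ ℂ H) (q : κ → ℝ≥0∞) :
    ∑' i, ∑' k, ENNReal.ofReal (‖⟪c k, b i⟫_ℂ‖ ^ 2) * q k = ∑' k, q k := by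
  rw [ENNReal.tsum_comm, ← tsum_eigenvalues_mul_inner_sq c b q]
  exact tsum_congr fun k => tsum_congr fun i => by rw [norm_inner_symm]

/-- Additivity of the scalar relative entropy, rearranged so that all terms are nonnegative. -/
theorem scalarRelEntropy_mul (p q p' q' : ℝ≥0) :
    scalarRelEntropy (p * p') (q * q') + (p' * q + p * q') =
      p' * scalarRelEntropy p q + p * scalarRelEntropy p' q' + (q * q' + p * p') := by
  unfold scalarRelEntropy
  rcases eq_or_ne p 0 with rfl | hp
  · simp [add_comm]
  rcases eq_or_ne p' 0 with rfl | hp'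
  · simp [add_comm]
  rcases eq_or_ne q 0 with rfl | hq
  · simp [hp, hp', ENNReal.mul_top]
  rcases eq_or_ne q' 0 with rfl | hq'
  · simp [hp, hp', ENNReal.mul_top]
  -- From `log x ≤ x - 1` at `x = b / a`; it ensures that `ENNReal.ofReal` truncates nothing.
  have hnn : ∀ {a b : ℝ≥0}, a ≠ 0 → b ≠ 0 →
      0 ≤ (a : ℝ) * Real.log a - a * Real.log b + b - a := fun {a b} ha hb => by
    have ha' : (0 : ℝ) < a := by positivity
    have hb' : (0 : ℝ) < b := by positivity
    have h := Real.log_le_sub_one_of_pos (div_pos hb' ha')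
    rw [Real.log_div hb'.ne' ha'.ne'] at h
    have h2 := mul_le_mul_of_nonneg_left h ha'.le
    have h3 : (a : ℝ) * (b / a - 1) = b - a := by field_simp
    nlinarith
  simp only [mul_eq_zero, hp, hp', hq, hq', or_self, if_false]
  have e : ∀ a : ℝ≥0, (a : ℝ≥0∞) = ENNReal.ofReal a := fun a => ENNReal.ofReal_coe_nnreal.symm
  simp only [e, ← ENNReal.ofReal_mul (NNReal.coe_nonneg _)]
  have h1 := hnn hp hq
  have h2 := hnn hp' hq'
  have h3 := hnn (mul_ne_zero hp hp') (mul_ne_zero hq hq')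
  rw [← ENNReal.ofReal_add (by positivity) (by positivity),
    ← ENNReal.ofReal_add h3 (by positivity),
    ← ENNReal.ofReal_add (by positivity) (by positivity),
    ← ENNReal.ofReal_add (by positivity) (by positivity),
    ← ENNReal.ofReal_add (by positivity) (by positivity)]
  congr 1
  have hp0 : (p : ℝ) ≠ 0 := by exact_mod_cast hp
  have hp0' : (p' : ℝ) ≠ 0 := by exact_mod_cast hp'
  have hq0 : (q : ℝ) ≠ 0 := by exact_mod_cast hq
  have hq0' : (q' : ℝ) ≠ 0 := by exact_mod_cast hq'
  push_cast
  rw [Real.log_mul hp0 hp0', Real.log_mul hq0 hq0']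
  ring

end Entropy

/-! ### Operators on the Hilbert tensor product; multiplicativity and additivity. -/

section TensorOperators

variable {H K : Type*} [NormedAddCommGroup H] [InnerProductSpace ℂ H]
  [NormedAddCommGroup K] [InnerProductSpace ℂ K]

/-- The elementary tensor `x ⊗ y` as an element of the Hilbert space tensor product. -/
def pureTensor (x : H) (y : K) : HilbertTensor H K := ((x ⊗ₜ[ℂ] y : H ⊗[ℂ] K) : HilbertTensor H K)

theorem inner_pureTensor (x x' : H) (y y' : K) :
    ⟪pureTensor x y, pureTensor x' y'⟫_ℂ = ⟪x, x'⟫_ℂ * ⟪y, y'⟫_ℂ := by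
  rw [pureTensor, pureTensor, UniformSpace.Completion.inner_coe, TensorProduct.inner_tmul]

theorem opTensor_pureTensor (A : H →L[ℂ] H) (B : K →L[ℂ] K) (x : H) (y : K) :
    opTensor A B (pureTensor x y) = pureTensor (A x) (B y) :=
  opTensor_tmul A B x y

/-- The continuous bilinear map `(x, y) ↦ x ⊗ y`. -/
def pureTensorL (H K : Type*) [NormedAddCommGroup H] [InnerProductSpace ℂ H]
    [NormedAddCommGroup K] [InnerProductSpace ℂ K] : H →L[ℂ] K →L[ℂ] HilbertTensor H K :=
  (ContinuousLinearMap.compL ℂ K (H ⊗[ℂ] K) (HilbertTensor H K)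
    UniformSpace.Completion.toComplL) ∘L (TensorProduct.mkL ℂ H K)

@[simp]
theorem pureTensorL_apply (x : H) (y : K) : pureTensorL H K x y = pureTensor x y := rfl

theorem hilbertTensor_mem_of_pureTensor_mem {W : Submodule ℂ (HilbertTensor H K)}
    (hW : IsClosed (W : Set (HilbertTensor H K))) (h : ∀ x y, pureTensor x y ∈ W)
    (z : HilbertTensor H K) : z ∈ W := by
  induction z using UniformSpace.Completion.induction_on with
  | hp => exact hW
  | ih z =>
    induction z using TensorProduct.induction_on with
    | zero =>
      rw [UniformSpace.Completion.coe_zero]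
      exact W.zero_mem
    | tmul x y => exact h x y
    | add x y hx hy =>
      rw [UniformSpace.Completion.coe_add]
      exact W.add_mem hx hy

theorem hilbertTensor_op_ext {E : Type*} [NormedAddCommGroup E] [NormedSpace ℂ E]
    {S T : HilbertTensor H K →L[ℂ] E}
    (h : ∀ x y, S (pureTensor x y) = T (pureTensor x y)) : S = T := by
  refine ContinuousLinearMap.ext fun z => ?_
  have := hilbertTensor_mem_of_pureTensor_mem (W := (S - T).ker) (S - T).isClosed_ker
    (fun x y => by rw [LinearMap.mem_ker]; exact sub_eq_zero.mpr (h x y)) z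
  rw [LinearMap.mem_ker] at this
  exact sub_eq_zero.mp this

theorem opTensor_mul (A A' : H →L[ℂ] H) (B B' : K →L[ℂ] K) :
    opTensor (A * A') (B * B') = opTensor A B * opTensor A' B' :=
  hilbertTensor_op_ext fun x y => by
    simp only [mul_apply_eq_comp, opTensor_pureTensor]

theorem norm_opTensor_le (A : H →L[ℂ] H) (B : K →L[ℂ] K) : ‖opTensor A B‖ ≤ ‖A‖ * ‖B‖ := by
  refine ContinuousLinearMap.opNorm_le_bound _ (by positivity) fun z => ?_
  induction z using UniformSpace.Completion.induction_on with
  | hp => exact isClosed_le (by fun_prop) (by fun_prop)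
  | ih z =>
    rw [opTensor, ContinuousLinearMap.completion_apply_coe, UniformSpace.Completion.norm_coe,
      UniformSpace.Completion.norm_coe]
    exact (ContinuousLinearMap.le_opNorm _ _).trans
      (mul_le_mul_of_nonneg_right (TensorProduct.norm_mapL_le A B) (norm_nonneg _))

theorem opTensor_add_left (A A' : H →L[ℂ] H) (B : K →L[ℂ] K) :
    opTensor (A + A') B = opTensor A B + opTensor A' B :=
  hilbertTensor_op_ext fun x y => by
    simp only [add_apply, opTensor_pureTensor]
    simp only [← pureTensorL_apply, map_add, add_apply]

theorem opTensor_add_right (A : H →L[ℂ] H) (B B' : K →L[ℂ] K) :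
    opTensor A (B + B') = opTensor A B + opTensor A B' :=
  hilbertTensor_op_ext fun x y => by
    simp only [add_apply, opTensor_pureTensor]
    simp only [← pureTensorL_apply, map_add]

theorem opTensor_smul_left (c : ℂ) (A : H →L[ℂ] H) (B : K →L[ℂ] K) :
    opTensor (c • A) B = c • opTensor A B :=
  hilbertTensor_op_ext fun x y => by
    simp only [smul_apply, opTensor_pureTensor]
    simp only [← pureTensorL_apply, map_smul, smul_apply]

theorem opTensor_smul_right (c : ℂ) (A : H →L[ℂ] H) (B : K →L[ℂ] K) :
    opTensor A (c • B) = c • opTensor A B :=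
  hilbertTensor_op_ext fun x y => by
    simp only [smul_apply, opTensor_pureTensor]
    simp only [← pureTensorL_apply, map_smul]

/-- The continuous bilinear map `(A, B) ↦ A ⊗ B`. -/
def opTensorL (H K : Type*) [NormedAddCommGroup H] [InnerProductSpace ℂ H]
    [NormedAddCommGroup K] [InnerProductSpace ℂ K] :
    (H →L[ℂ] H) →L[ℂ] (K →L[ℂ] K) →L[ℂ] (HilbertTensor H K →L[ℂ] HilbertTensor H K) :=
  LinearMap.mkContinuous₂ (E := H →L[ℂ] H) (F := K →L[ℂ] K)
    (G := HilbertTensor H K →L[ℂ] HilbertTensor H K)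
    (LinearMap.mk₂ ℂ opTensor opTensor_add_left opTensor_smul_left opTensor_add_right
      opTensor_smul_right) 1 (fun A B => (norm_opTensor_le A B).trans_eq (by rw [one_mul]))

@[simp]
theorem opTensorL_apply (A : H →L[ℂ] H) (B : K →L[ℂ] K) :
    opTensorL H K A B = opTensor A B := rfl

theorem opTensor_adjoint [CompleteSpace H] [CompleteSpace K] (A : H →L[ℂ] H) (B : K →L[ℂ] K) :
    ContinuousLinearMap.adjoint (opTensor A B) =
      opTensor (ContinuousLinearMap.adjoint A) (ContinuousLinearMap.adjoint B) := by
  refine hilbertTensor_op_ext fun x y => ?_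
  refine ext_inner_left ℂ fun z => ?_
  have h := hilbertTensor_op_ext (S := innerSL ℂ (ContinuousLinearMap.adjoint (opTensor A B)
      (pureTensor x y)))
    (T := innerSL ℂ (opTensor (ContinuousLinearMap.adjoint A) (ContinuousLinearMap.adjoint B)
      (pureTensor x y))) (fun x' y' => by
      simp only [innerSL_apply_apply, ContinuousLinearMap.adjoint_inner_left, opTensor_pureTensor,
        inner_pureTensor])
  have h2 := DFunLike.congr_fun h z
  simp only [innerSL_apply_apply] at h2
  rw [← inner_conj_symm, h2, inner_conj_symm]

theorem isPositive_opTensor [CompleteSpace H] [CompleteSpace K] {A : H →L[ℂ] H} {B : K →L[ℂ] K}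
    (hA : A.IsPositive) (hB : B.IsPositive) : (opTensor A B).IsPositive := by
  obtain ⟨S, hS, -⟩ := exists_re_inner_eq_norm_sq hA
  obtain ⟨T, hT, -⟩ := exists_re_inner_eq_norm_sq hB
  rw [hS, hT, opTensor_mul, ← opTensor_adjoint]
  exact ContinuousLinearMap.isPositive_adjoint_comp_self _

theorem orthonormal_pureTensor {ι κ : Type*} {b : ι → H} {c : κ → K} (hb : Orthonormal ℂ b)
    (hc : Orthonormal ℂ c) : Orthonormal ℂ fun ij : ι × κ => pureTensor (b ij.1) (c ij.2) :=
  (hb.tmul hc).comp_linearIsometry UniformSpace.Completion.toComplₗᵢ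

/-- One factor is approximated at a time, using continuity of `⊗` in each variable separately. -/
theorem top_le_closure_span_pureTensor {ι κ : Type*} (b : HilbertBasis ι ℂ H)
    (c : HilbertBasis κ ℂ K) :
    ⊤ ≤ (Submodule.span ℂ
      (Set.range fun ij : ι × κ => pureTensor (b ij.1) (c ij.2))).topologicalClosure := by
  set W := (Submodule.span ℂ
    (Set.range fun ij : ι × κ => pureTensor (b ij.1) (c ij.2))).topologicalClosure with hWdef
  have hW : IsClosed (W : Set (HilbertTensor H K)) := Submodule.isClosed_topologicalClosure _
  have h0 : ∀ i j, pureTensor (b i) (c j) ∈ W := fun i j =>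
    Submodule.le_topologicalClosure _ (Submodule.subset_span ⟨(i, j), rfl⟩)
  have h1 : ∀ x j, pureTensor x (c j) ∈ W := fun x j => by
    have hle : (Submodule.span ℂ (Set.range b)).topologicalClosure ≤
        W.comap ((pureTensorL H K).flip (c j)).toLinearMap :=
      Submodule.topologicalClosure_minimal _
        (Submodule.span_le.mpr (by rintro _ ⟨i, rfl⟩; exact h0 i j))
        (hW.preimage ((pureTensorL H K).flip (c j)).continuous)
    rw [b.dense_span] at hle
    exact hle (Submodule.mem_top (x := x))
  have h2 : ∀ x y, pureTensor x y ∈ W := fun x y => by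
    have hle : (Submodule.span ℂ (Set.range c)).topologicalClosure ≤
        W.comap (pureTensorL H K x).toLinearMap :=
      Submodule.topologicalClosure_minimal _
        (Submodule.span_le.mpr (by rintro _ ⟨j, rfl⟩; exact h1 x j))
        (hW.preimage (pureTensorL H K x).continuous)
    rw [c.dense_span] at hle
    exact hle (Submodule.mem_top (x := y))
  exact fun z _ => hilbertTensor_mem_of_pureTensor_mem hW h2 z

/-- The product Hilbert basis of the Hilbert space tensor product. -/
def tensorBasis {ι κ : Type*} (b : HilbertBasis ι ℂ H) (c : HilbertBasis κ ℂ K) :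
    HilbertBasis (ι × κ) ℂ (HilbertTensor H K) :=
  HilbertBasis.mk (orthonormal_pureTensor b.orthonormal c.orthonormal)
    (top_le_closure_span_pureTensor b c)

@[simp]
theorem tensorBasis_apply {ι κ : Type*} (b : HilbertBasis ι ℂ H) (c : HilbertBasis κ ℂ K)
    (ij : ι × κ) : tensorBasis b c ij = pureTensor (b ij.1) (c ij.2) := by
  rw [tensorBasis, HilbertBasis.coe_mk]

variable [CompleteSpace H] [CompleteSpace K]

theorem posTrace_opTensor {A : H →L[ℂ] H} {B : K →L[ℂ] K} (hA : A.IsPositive)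
    (hB : B.IsPositive) : posTrace (opTensor A B) = posTrace A * posTrace B := by
  obtain ⟨w, b, -⟩ := exists_hilbertBasis ℂ H
  obtain ⟨w', c, -⟩ := exists_hilbertBasis ℂ K
  rw [posTrace_eq_tsum (tensorBasis b c) (isPositive_opTensor hA hB), posTrace_eq_tsum b hA,
    posTrace_eq_tsum c hB, ENNReal.tsum_prod', ← ENNReal.tsum_mul_right]
  refine tsum_congr fun i => ?_
  rw [← ENNReal.tsum_mul_left]
  refine tsum_congr fun j => ?_
  rw [tensorBasis_apply, opTensor_pureTensor, inner_pureTensor,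
    ← ENNReal.ofReal_mul (Complex.nonneg_iff.mp (hA.inner_nonneg_right (b i))).1]
  congr 1
  have h1 := Complex.nonneg_iff.mp (hA.inner_nonneg_right (b i))
  rw [Complex.mul_re, ← h1.2, zero_mul, sub_zero]

theorem IsDensityOperator.opTensor {A : H →L[ℂ] H} {B : K →L[ℂ] K} (hA : IsDensityOperator A)
    (hB : IsDensityOperator B) : IsDensityOperator (opTensor A B) :=
  ⟨isPositive_opTensor hA.isPositive hB.isPositive, by
    rw [posTrace_opTensor hA.isPositive hB.isPositive, hA.posTrace_eq_one, hB.posTrace_eq_one,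
      one_mul]⟩

theorem purity_opTensor {A : H →L[ℂ] H} {B : K →L[ℂ] K} (hA : A.IsPositive)
    (hB : B.IsPositive) : purity (opTensor A B) = purity A * purity B := by
  rw [purity, ← opTensor_mul, posTrace_opTensor (isPositive_mul_self hA) (isPositive_mul_self hB),
    ENNReal.toReal_mul, purity, purity]

theorem tsum_tsum_tsum_tsum_mul {ι κ ι' κ' : Type*} (f : ι → κ → ℝ≥0∞) (g : ι' → κ' → ℝ≥0∞) :
    ∑' ij : ι × ι', ∑' kl : κ × κ', f ij.1 kl.1 * g ij.2 kl.2 =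
      (∑' i, ∑' k, f i k) * ∑' j, ∑' l, g j l := by
  rw [ENNReal.tsum_prod', ← ENNReal.tsum_mul_right]
  refine tsum_congr fun i => ?_
  rw [← ENNReal.tsum_mul_left]
  refine tsum_congr fun j => ?_
  rw [ENNReal.tsum_prod', ← ENNReal.tsum_mul_right]
  refine tsum_congr fun k => ?_
  rw [← ENNReal.tsum_mul_left]

/-- The relative entropy of states is additive under tensor products. -/
theorem relEntropy_opTensor {ρ σ : H →L[ℂ] H} {ρ' σ' : K →L[ℂ] K} (hρ : IsDensityOperator ρ)
    (hσ : IsDensityOperator σ) (hρ' : IsDensityOperator ρ') (hσ' : IsDensityOperator σ') :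
    relEntropy (opTensor ρ ρ') (opTensor σ σ') = relEntropy ρ σ + relEntropy ρ' σ' := by
  obtain ⟨ι, b, p, hb⟩ := exists_eigenbasis hρ.isPositive (by rw [hρ.posTrace_eq_one]; simp)
  obtain ⟨κ, c, q, hc⟩ := exists_eigenbasis hσ.isPositive (by rw [hσ.posTrace_eq_one]; simp)
  obtain ⟨ι', b', p', hb'⟩ :=
    exists_eigenbasis hρ'.isPositive (by rw [hρ'.posTrace_eq_one]; simp)
  obtain ⟨κ', c', q', hc'⟩ :=
    exists_eigenbasis hσ'.isPositive (by rw [hσ'.posTrace_eq_one]; simp)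
  have tp := hρ.posTrace_eq_one
  have tq := hσ.posTrace_eq_one
  have tp' := hρ'.posTrace_eq_one
  have tq' := hσ'.posTrace_eq_one
  rw [posTrace_eq_tsum_eigenvalues hρ.isPositive b hb] at tp
  rw [posTrace_eq_tsum_eigenvalues hσ.isPositive c hc] at tq
  rw [posTrace_eq_tsum_eigenvalues hρ'.isPositive b' hb'] at tp'
  rw [posTrace_eq_tsum_eigenvalues hσ'.isPositive c' hc'] at tq'
  have eig : ∀ {α β : Type _} {A : H →L[ℂ] H} {B : K →L[ℂ] K} (d : HilbertBasis α ℂ H)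
      (e : HilbertBasis β ℂ K) (r : α → ℝ≥0) (s : β → ℝ≥0),
      (∀ i, A (d i) = ((r i : ℝ) : ℂ) • d i) → (∀ j, B (e j) = ((s j : ℝ) : ℂ) • e j) →
      ∀ ij, opTensor A B (tensorBasis d e ij) =
        (((r ij.1 * s ij.2 : ℝ≥0) : ℝ) : ℂ) • tensorBasis d e ij := by
    intro α β A B d e r s hd he ij
    rw [tensorBasis_apply, opTensor_pureTensor, hd, he]
    simp only [← pureTensorL_apply, map_smul, smul_apply, smul_smul]
    push_cast
    rw [mul_comm]
  rw [relEntropy_eq_tsum (isPositive_opTensor hρ.isPositive hρ'.isPositive)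
    (isPositive_opTensor hσ.isPositive hσ'.isPositive) (tensorBasis b b') (tensorBasis c c')
    (eig b b' p p' hb hb') (eig c c' q q' hc hc'),
    relEntropy_eq_tsum hρ.isPositive hσ.isPositive b c hb hc,
    relEntropy_eq_tsum hρ'.isPositive hσ'.isPositive b' c' hb' hc']
  set w : ι → κ → ℝ≥0∞ := fun i k => ENNReal.ofReal (‖⟪c k, b i⟫_ℂ‖ ^ 2) with hw
  set w' : ι' → κ' → ℝ≥0∞ := fun j l => ENNReal.ofReal (‖⟪c' l, b' j⟫_ℂ‖ ^ 2) with hw'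
  have hww : ∀ (ij : ι × ι') (kl : κ × κ'), ENNReal.ofReal
      (‖⟪tensorBasis c c' kl, tensorBasis b b' ij⟫_ℂ‖ ^ 2) = w ij.1 kl.1 * w' ij.2 kl.2 := by
    intro ij kl
    rw [tensorBasis_apply, tensorBasis_apply, inner_pureTensor, norm_mul, mul_pow,
      ENNReal.ofReal_mul (by positivity)]
  have wp : ∑' i, ∑' k, w i k * p i = 1 := by
    rw [tsum_eigenvalues_mul_inner_sq b c (fun i => (p i : ℝ≥0∞)), tp]
  have wq : ∑' i, ∑' k, w i k * q k = 1 := by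
    rw [tsum_eigenvalues_mul_inner_sq' b c (fun k => (q k : ℝ≥0∞)), tq]
  have wp' : ∑' j, ∑' l, w' j l * p' j = 1 := by
    rw [tsum_eigenvalues_mul_inner_sq b' c' (fun i => (p' i : ℝ≥0∞)), tp']
  have wq' : ∑' j, ∑' l, w' j l * q' l = 1 := by
    rw [tsum_eigenvalues_mul_inner_sq' b' c' (fun k => (q' k : ℝ≥0∞)), tq']
  -- The scalar identity is summed against the product weights; each of the six resulting sums
  -- factorizes.
  have key := tsum_congr (L := .unconditional _) fun ij : ι × ι' =>
    tsum_congr (L := .unconditional _) fun kl : κ × κ' =>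
    congrArg (fun t => w ij.1 kl.1 * w' ij.2 kl.2 * t)
      (scalarRelEntropy_mul (p ij.1) (q kl.1) (p' ij.2) (q' kl.2))
  simp only [mul_add, ENNReal.tsum_add] at key
  have split : ∀ (f : ι → κ → ℝ≥0∞) (g : ι' → κ' → ℝ≥0∞) (h : ι × ι' → κ × κ' → ℝ≥0∞),
      (∀ ij kl, h ij kl = f ij.1 kl.1 * g ij.2 kl.2) →
      ∑' ij, ∑' kl, w ij.1 kl.1 * w' ij.2 kl.2 * h ij kl =
        (∑' i, ∑' k, w i k * f i k) * ∑' j, ∑' l, w' j l * g j l := by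
    intro f g h hh
    rw [← tsum_tsum_tsum_tsum_mul]
    refine tsum_congr fun ij => tsum_congr fun kl => ?_
    rw [hh]; ring
  rw [split (fun i k => q k) (fun j l => p' j) _ (fun ij kl => mul_comm _ _),
    split (fun i k => p i) (fun j l => q' l) _ (fun ij kl => rfl),
    split (fun i k => scalarRelEntropy (p i) (q k)) (fun j l => p' j) _
      (fun ij kl => mul_comm _ _),
    split (fun i k => p i) (fun j l => scalarRelEntropy (p' j) (q' l)) _ (fun ij kl => rfl),
    split (fun i k => q k) (fun j l => q' l) _ (fun ij kl => rfl),
    split (fun i k => p i) (fun j l => p' j) _ (fun ij kl => rfl), wp, wq, wp', wq',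
    one_mul, one_mul, mul_one] at key
  simp_rw [hww]
  -- The linear terms contribute `1 + 1` on either side; being finite, this cancels even if the
  -- entropies are `∞`.
  exact (ENNReal.add_left_inj (by simp)).mp key

end TensorOperators

/-! ### Momentum kicks as a unitary group, and the dephasing channel. -/

section Kicks

theorem phase_add (ħ p q x : ℝ) : phase ħ (p + q) x = phase ħ p x * phase ħ q x := by
  rw [phase, phase, phase, ← Complex.exp_add]
  congr 1
  push_cast
  ring

theorem phase_zero (ħ x : ℝ) : phase ħ 0 x = 1 := by simp [phase]

theorem conj_phase (ħ p x : ℝ) : (starRingEnd ℂ) (phase ħ p x) = phase ħ (-p) x := by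
  rw [phase, phase, ← Complex.exp_conj]
  congr 1
  simp
  ring

theorem continuous_phase_left (ħ x : ℝ) : Continuous fun p => phase ħ p x := by
  unfold phase; fun_prop

theorem kick_mul_kick (ħ p q : ℝ) : kick ħ p * kick ħ q = kick ħ (p + q) := by
  refine ContinuousLinearMap.ext fun ψ => ?_
  rw [mul_apply_eq_comp]
  refine Lp.ext ?_
  filter_upwards [coeFn_kick ħ p (kick ħ q ψ), coeFn_kick ħ q ψ, coeFn_kick ħ (p + q) ψ]
    with x h1 h2 h3
  rw [h1, h2, h3, phase_add, mul_assoc]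

theorem kick_zero (ħ : ℝ) : kick ħ 0 = 1 := by
  refine ContinuousLinearMap.ext fun ψ => Lp.ext ?_
  filter_upwards [coeFn_kick ħ 0 ψ] with x h1
  rw [h1, phase_zero, one_mul]
  rfl

theorem inner_kick_right (ħ p : ℝ) (φ ψ : L2R) :
    ⟪φ, kick ħ p ψ⟫_ℂ = ⟪kick ħ (-p) φ, ψ⟫_ℂ := by
  rw [L2.inner_def, L2.inner_def]
  refine integral_congr_ae ?_
  filter_upwards [coeFn_kick ħ p ψ, coeFn_kick ħ (-p) φ] with x h1 h2
  rw [h1, h2]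
  simp only [RCLike.inner_apply, map_mul, conj_phase, neg_neg]
  ring

theorem adjoint_kick (ħ p : ℝ) : ContinuousLinearMap.adjoint (kick ħ p) = kick ħ (-p) := by
  rw [eq_comm, ContinuousLinearMap.eq_adjoint_iff]
  intro φ ψ
  rw [inner_kick_right]

theorem norm_kick_apply (ħ p : ℝ) (ψ : L2R) : ‖kick ħ p ψ‖ = ‖ψ‖ := by
  have h : ‖kick ħ p ψ‖ ^ 2 = ‖ψ‖ ^ 2 := by
    rw [← inner_self_eq_norm_sq (𝕜 := ℂ), inner_kick_right, ← mul_apply_eq_comp, kick_mul_kick,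
      neg_add_cancel, kick_zero, ← inner_self_eq_norm_sq (𝕜 := ℂ)]
    rfl
  exact (sq_eq_sq₀ (norm_nonneg _) (norm_nonneg _)).mp h

theorem norm_kick_le (ħ p : ℝ) : ‖kick ħ p‖ ≤ 1 :=
  ContinuousLinearMap.opNorm_le_bound _ zero_le_one fun ψ => by rw [norm_kick_apply, one_mul]

theorem inner_kick_self (ħ p : ℝ) (φ ψ : L2R) :
    ⟪φ, kick ħ p ψ⟫_ℂ = ∫ x, phase ħ p x * ⟪φ x, ψ x⟫_ℂ := by
  rw [L2.inner_def]
  refine integral_congr_ae ?_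
  filter_upwards [coeFn_kick ħ p ψ] with x h1
  rw [h1]
  simp only [RCLike.inner_apply]
  ring

theorem continuous_inner_kick (ħ : ℝ) (φ ψ : L2R) :
    Continuous fun p => ⟪φ, kick ħ p ψ⟫_ℂ := by
  simp_rw [inner_kick_self]
  have hint := L2.integrable_inner (𝕜 := ℂ) φ ψ
  refine continuous_of_dominated (bound := fun x => ‖⟪φ x, ψ x⟫_ℂ‖)
    (fun p => (continuous_phase ħ p).aestronglyMeasurable.mul hint.aestronglyMeasurable)
    (fun p => Filter.Eventually.of_forall fun x => ?_) hint.norm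
    (Filter.Eventually.of_forall fun x => (continuous_phase_left ħ x).mul continuous_const)
  rw [norm_mul, norm_phase, one_mul]

/-- The momentum kicks form a strongly continuous group. -/
theorem continuous_kick_apply (ħ : ℝ) (ψ : L2R) : Continuous fun p => kick ħ p ψ := by
  rw [continuous_iff_continuousAt]
  intro q
  rw [ContinuousAt, tendsto_iff_norm_sub_tendsto_zero]
  -- For isometries the distance depends on `p` only through an inner product, so weak continuity
  -- gives strong continuity.
  have key : ∀ p, ‖kick ħ p ψ - kick ħ q ψ‖ =
      √(‖ψ‖ ^ 2 - 2 * (⟪kick ħ q ψ, kick ħ p ψ⟫_ℂ).re + ‖ψ‖ ^ 2) := fun p => by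
    have h := norm_sub_sq (𝕜 := ℂ) (kick ħ p ψ) (kick ħ q ψ)
    rw [norm_kick_apply, norm_kick_apply, inner_re_symm] at h
    rw [← Real.sqrt_sq (norm_nonneg (kick ħ p ψ - kick ħ q ψ)), h]
    rfl
  have hc : Continuous fun p => ‖kick ħ p ψ - kick ħ q ψ‖ := by
    simp_rw [key]
    have := continuous_inner_kick ħ (kick ħ q ψ) ψ
    fun_prop
  simpa using hc.tendsto q

theorem kick_mul_rankOne_mul_kick (ħ p : ℝ) (φ ψ : L2R) :
    kick ħ p * InnerProductSpace.rankOne ℂ φ ψ * kick ħ (-p) =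
      InnerProductSpace.rankOne ℂ (kick ħ p φ) (kick ħ p ψ) := by
  refine ContinuousLinearMap.ext fun x => ?_
  simp only [mul_apply_eq_comp, InnerProductSpace.rankOne_apply, map_smul, inner_kick_right,
    neg_neg]

theorem norm_kick_conj_le (ħ p : ℝ) (ρ : L2R →L[ℂ] L2R) :
    ‖kick ħ p * ρ * kick ħ (-p)‖ ≤ ‖ρ‖ :=
  calc ‖kick ħ p * ρ * kick ħ (-p)‖ ≤ ‖kick ħ p‖ * ‖ρ‖ * ‖kick ħ (-p)‖ := norm_mul₃_le
    _ ≤ 1 * ‖ρ‖ * 1 := by gcongr <;> exact norm_kick_le _ _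
    _ = ‖ρ‖ := by ring

/-- The kicks act norm continuously on trace-class operators. -/
theorem continuous_kick_conj (ħ : ℝ) {ρ : L2R →L[ℂ] L2R} (hρ : ρ.IsPositive)
    (htr : posTrace ρ ≠ ∞) : Continuous fun p => kick ħ p * ρ * kick ħ (-p) := by
  obtain ⟨w, b, -⟩ := exists_hilbertBasis ℂ L2R
  have hs := hasSum_rankOne_of_posTrace_ne_top b hρ htr
  -- Conjugation by kicks does not increase the norm, so finite-rank approximation is uniform in
  -- `p`. For rank-one operators strong continuity of the kicks suffices.
  have hu : TendstoUniformly (fun (s : Finset w) p => kick ħ p *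
      (∑ i ∈ s, InnerProductSpace.rankOne ℂ (ρ (b i)) (b i)) * kick ħ (-p))
      (fun p => kick ħ p * ρ * kick ħ (-p)) Filter.atTop := by
    rw [Metric.tendstoUniformly_iff]
    intro ε hε
    filter_upwards [Metric.tendsto_nhds.mp hs ε hε] with s h p
    rw [dist_eq_norm] at h ⊢
    rw [← sub_mul, ← mul_sub]
    rw [norm_sub_rev] at h
    exact (norm_kick_conj_le ħ p _).trans_lt h
  refine hu.continuous (Filter.Eventually.of_forall fun s => ?_).frequently
  simp_rw [Finset.mul_sum, Finset.sum_mul, kick_mul_rankOne_mul_kick]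
  refine continuous_finsetSum _ fun i _ => ?_
  exact ((ContinuousLinearMap.smulRightL ℂ L2R L2R).continuous.comp
    ((innerSL ℂ).continuous.comp (continuous_kick_apply ħ (b i)))).clm_apply
    (continuous_kick_apply ħ (ρ (b i)))

variable {ħ : ℝ} {μ : Measure ℝ} [IsProbabilityMeasure μ] {ρ : L2R →L[ℂ] L2R}

theorem integrable_kick_conj (hρ : ρ.IsPositive) (htr : posTrace ρ ≠ ∞) :
    Integrable (fun p => kick ħ p * ρ * kick ħ (-p)) μ :=
  Integrable.of_bound (continuous_kick_conj ħ hρ htr).aestronglyMeasurable ‖ρ‖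
    (Filter.Eventually.of_forall fun p => norm_kick_conj_le ħ p ρ)

theorem inner_dephase (hρ : ρ.IsPositive) (htr : posTrace ρ ≠ ∞) (x y : L2R) :
    ⟪x, dephase ħ μ ρ y⟫_ℂ = ∫ p, ⟪kick ħ (-p) x, ρ (kick ħ (-p) y)⟫_ℂ ∂μ := by
  have h := integrable_kick_conj (ħ := ħ) (μ := μ) hρ htr
  rw [dephase, ContinuousLinearMap.integral_apply h, ← integral_inner (h.apply_continuousLinearMap y)]
  simp_rw [mul_apply_eq_comp, inner_kick_right]

theorem inner_dephase_self (hρ : ρ.IsPositive) (htr : posTrace ρ ≠ ∞) (x : L2R) :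
    ⟪x, dephase ħ μ ρ x⟫_ℂ =
      ((∫ p, (⟪kick ħ (-p) x, ρ (kick ħ (-p) x)⟫_ℂ).re ∂μ : ℝ) : ℂ) := by
  rw [inner_dephase hρ htr, ← integral_complex_ofReal]
  refine integral_congr_ae (Filter.Eventually.of_forall fun p => ?_)
  exact Complex.eq_re_of_ofReal_le (r := 0) (by simpa using hρ.inner_nonneg_right _)

theorem continuous_inner_kick_conj (ħ : ℝ) (ρ : L2R →L[ℂ] L2R) (x : L2R) :
    Continuous fun p => (⟪kick ħ (-p) x, ρ (kick ħ (-p) x)⟫_ℂ).re := by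
  have := (continuous_kick_apply ħ x).comp continuous_neg
  fun_prop

theorem isPositive_dephase (hρ : ρ.IsPositive) (htr : posTrace ρ ≠ ∞) :
    (dephase ħ μ ρ).IsPositive := by
  rw [ContinuousLinearMap.isPositive_iff_complex]
  intro x
  have h := inner_dephase_self (ħ := ħ) (μ := μ) hρ htr x
  rw [← inner_conj_symm, h, Complex.conj_ofReal]
  refine ⟨rfl, integral_nonneg fun p => hρ.re_inner_nonneg_right _⟩

/-- Unitary invariance of the trace: with `ρ = S* S`, passing to adjoints moves the kick to the
outside, where it preserves norms. -/
theorem posTrace_kick_conj (hρ : ρ.IsPositive) {ι : Type*} (b : HilbertBasis ι ℂ L2R) (p : ℝ) :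
    ∑' i, ENNReal.ofReal (⟪kick ħ p (b i), ρ (kick ħ p (b i))⟫_ℂ).re = posTrace ρ := by
  obtain ⟨S, -, hin⟩ := exists_re_inner_eq_norm_sq hρ
  rw [posTrace_eq_tsum b hρ]
  simp_rw [hin]
  have h := tsum_norm_sq_adjoint b b (S * kick ħ p)
  simp only [mul_apply_eq_comp] at h
  rw [h, tsum_norm_sq_adjoint b b S]
  refine tsum_congr fun i => ?_
  rw [ContinuousLinearMap.mul_def, ContinuousLinearMap.adjoint_comp, adjoint_kick,
    ContinuousLinearMap.comp_apply, norm_kick_apply]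

/-- Distinct basis vectors are `√2` apart, so the balls of radius `1/2` are disjoint. Countability
licenses the exchange of trace and integral in `IsDensityOperator.dephase`. -/
theorem countable_of_hilbertBasis {H ι : Type*} [NormedAddCommGroup H] [InnerProductSpace ℂ H]
    [TopologicalSpace.SeparableSpace H] (b : HilbertBasis ι ℂ H) : Countable ι := by
  refine Pairwise.countable_of_isOpen_disjoint (s := fun i => Metric.ball (b i) (1 / 2))
    (fun i j hij => ?_) (fun i => Metric.isOpen_ball)
    (fun i => ⟨b i, Metric.mem_ball_self (by norm_num)⟩)
  refine Metric.ball_disjoint_ball ?_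
  have h := norm_sub_sq (𝕜 := ℂ) (b i) (b j)
  rw [b.orthonormal.2 hij, b.orthonormal.1, b.orthonormal.1] at h
  simp only [map_zero] at h
  rw [dist_eq_norm]
  nlinarith [norm_nonneg (b i - b j)]

theorem IsDensityOperator.dephase (hρ : IsDensityOperator ρ) :
    IsDensityOperator (dephase ħ μ ρ) := by
  have htr : posTrace ρ ≠ ∞ := by rw [hρ.posTrace_eq_one]; simp
  refine ⟨isPositive_dephase hρ.isPositive htr, ?_⟩
  obtain ⟨w, b, -⟩ := exists_hilbertBasis ℂ L2R
  have : Fact ((2 : ℝ≥0∞) ≠ ∞) := ⟨by simp⟩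
  have := countable_of_hilbertBasis b
  rw [posTrace_eq_tsum b (isPositive_dephase hρ.isPositive htr)]
  have hc := fun i => continuous_inner_kick_conj ħ ρ (b i)
  have h1 : ∀ i, ENNReal.ofReal (⟪b i, Dephasing.dephase ħ μ ρ (b i)⟫_ℂ).re =
      ∫⁻ p, ENNReal.ofReal (⟪kick ħ (-p) (b i), ρ (kick ħ (-p) (b i))⟫_ℂ).re ∂μ := fun i => by
    rw [inner_dephase_self hρ.isPositive htr, Complex.ofReal_re,
      ofReal_integral_eq_lintegral_ofReal]
    · refine Integrable.of_bound (hc i).aestronglyMeasurable ‖ρ‖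
        (Filter.Eventually.of_forall fun p => ?_)
      refine (Complex.abs_re_le_norm _).trans ((norm_inner_le_norm _ _).trans ?_)
      refine (mul_le_mul_of_nonneg_left (ρ.le_opNorm _) (norm_nonneg _)).trans_eq ?_
      rw [norm_kick_apply, b.orthonormal.1 i]; ring
    · exact Filter.Eventually.of_forall fun p => hρ.isPositive.re_inner_nonneg_right _
  simp_rw [h1]
  -- Tonelli: the trace of the average is the average of the traces, each equal to `1`.
  rw [← lintegral_tsum fun i => (hc i).measurable.ennreal_ofReal.aemeasurable]
  simp_rw [posTrace_kick_conj hρ.isPositive b, hρ.posTrace_eq_one]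
  simp

theorem dephaseProd_opTensor {μ' : Measure ℝ} [IsProbabilityMeasure μ'] {σ : L2R →L[ℂ] L2R}
    (hρ : IsDensityOperator ρ) (hσ : IsDensityOperator σ) :
    dephaseProd ħ μ μ' (opTensor ρ σ) = opTensor (dephase ħ μ ρ) (dephase ħ μ' σ) := by
  have h := integral_prod_bilin (𝕜 := ℂ)
    (G := HilbertTensor L2R L2R →L[ℂ] HilbertTensor L2R L2R) (opTensorL L2R L2R)
    (integrable_kick_conj (ħ := ħ) (μ := μ) hρ.isPositive (by rw [hρ.posTrace_eq_one]; simp))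
    (integrable_kick_conj (ħ := ħ) (μ := μ') hσ.isPositive (by rw [hσ.posTrace_eq_one]; simp))
  simp only [opTensorL_apply] at h
  rw [dephaseProd, dephase, dephase, ← h]
  simp_rw [opTensor_mul]

end Kicks

/-! ### Strict loss of purity for a nowhere vanishing pure state. -/

section Purity

/-- A normalized Gaussian. Its lack of zeros allows division by the wave function, reducing
proportional kicks to proportional phases. -/
theorem exists_unit_ae_ne_zero : ∃ ψ : L2R, ‖ψ‖ = 1 ∧ ∀ᵐ x, ψ x ≠ 0 := by
  have hm : MemLp (fun x : ℝ => ((Real.exp (-1 * x ^ 2) : ℝ) : ℂ)) 2 volume := by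
    rw [memLp_two_iff_integrable_sq_norm (by fun_prop)]
    refine (integrable_exp_neg_mul_sq (b := 2) (by norm_num)).congr
      (Filter.Eventually.of_forall fun x => ?_)
    simp only [Complex.norm_real, Real.norm_eq_abs, Real.abs_exp, ← Real.exp_nat_mul]
    congr 1
    push_cast
    ring
  obtain ⟨f, hf⟩ : ∃ f : L2R, f = hm.toLp _ := ⟨_, rfl⟩
  have hne : ∀ᵐ x, f x ≠ 0 := by
    filter_upwards [hm.coeFn_toLp] with x hx
    rw [hf]
    rw [hx]
    exact_mod_cast (Real.exp_pos _).ne'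
  have h0 : f ≠ 0 := fun h => by
    have h1 : ∀ᵐ x : ℝ, False := by
      filter_upwards [hne, Lp.coeFn_zero ℂ 2 (volume : Measure ℝ)] with x hx h2
      rw [h, h2] at hx
      exact hx rfl
    rw [Filter.eventually_false_iff_eq_bot, ae_eq_bot] at h1
    exact NeZero.ne (volume : Measure ℝ) h1
  refine ⟨((‖f‖ : ℂ)⁻¹) • f, norm_smul_inv_norm h0, ?_⟩
  filter_upwards [hne, Lp.coeFn_smul ((‖f‖ : ℂ)⁻¹) f] with x hx h2
  rw [h2, Pi.smul_apply, smul_eq_mul]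
  exact mul_ne_zero (inv_ne_zero (by exact_mod_cast norm_ne_zero_iff.mpr h0)) hx

/-- Two kicks of a nowhere vanishing wave function are proportional only if they coincide. -/
theorem eq_of_kick_eq_smul_kick {ħ : ℝ} (hħ : 0 < ħ) {ψ : L2R} (hψ : ∀ᵐ x, ψ x ≠ 0) {p q : ℝ}
    {c : ℂ} (h : kick ħ p ψ = c • kick ħ q ψ) : p = q := by
  have h1 : phase ħ p =ᵐ[volume] fun x => c * phase ħ q x := by
    have h2 : (kick ħ p ψ : ℝ → ℂ) =ᵐ[volume] (c • kick ħ q ψ : L2R) := by rw [h]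
    filter_upwards [h2, hψ, coeFn_kick ħ p ψ, coeFn_kick ħ q ψ, Lp.coeFn_smul c (kick ħ q ψ)]
      with x a1 a2 a3 a4 a5
    rw [a3, a5, Pi.smul_apply, smul_eq_mul, a4, ← mul_assoc] at a1
    exact mul_right_cancel₀ a2 a1
  have h2 := (Continuous.ae_eq_iff_eq volume (continuous_phase ħ p)
    (continuous_const.mul (continuous_phase ħ q))).mp h1
  have hc : c = 1 := by
    have := congrFun h2 0
    simpa [phase] using this.symm
  by_contra hpq
  -- At this point the relative phase is `e^{iπ} = -1`, whereas equality of the phases would make it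
  -- `1`.
  have h3 := congrFun h2 (Real.pi * ħ / (p - q))
  simp only [Pi.mul_apply, hc, one_mul] at h3
  have h4 : phase ħ (p - q) (Real.pi * ħ / (p - q)) = 1 := by
    rw [sub_eq_add_neg p q, phase_add, ← conj_phase, ← sub_eq_add_neg, h3, Complex.mul_conj,
      Complex.normSq_eq_norm_sq, norm_phase]
    simp
  have h5 : (p - q) * (Real.pi * ħ / (p - q)) / ħ = Real.pi := by
    have : p - q ≠ 0 := sub_ne_zero.mpr hpq
    field_simp
  rw [phase, h5, mul_comm, Complex.exp_pi_mul_I] at h4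
  norm_num at h4

/-- Dephasing strictly lowers the purity of a nowhere vanishing pure state, unless the kick
distribution is concentrated at a point. -/
theorem purity_dephase_ne_one {ħ : ℝ} (hħ : 0 < ħ) {μ : Measure ℝ} [IsProbabilityMeasure μ]
    (hμ : ∃ ξ, ‖dephasingFun ħ μ ξ‖ < 1) {ψ : L2R} (hn : ‖ψ‖ = 1) (hψ : ∀ᵐ x, ψ x ≠ 0) :
    purity (dephase ħ μ (InnerProductSpace.rankOne ℂ ψ ψ)) ≠ 1 := by
  intro hpur
  have hρ := isDensityOperator_rankOne_self hn
  have htr : posTrace (InnerProductSpace.rankOne ℂ ψ ψ) ≠ ∞ := by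
    rw [hρ.posTrace_eq_one]; simp
  obtain ⟨φ, hφ, hT⟩ := exists_eigenvector_one_of_purity_eq_one
    (hρ.dephase (ħ := ħ) (μ := μ)) hpur
  have hin : ∀ p, (⟪kick ħ (-p) φ,
      InnerProductSpace.rankOne ℂ ψ ψ (kick ħ (-p) φ)⟫_ℂ).re = ‖⟪φ, kick ħ p ψ⟫_ℂ‖ ^ 2 := by
    intro p
    rw [InnerProductSpace.rankOne_apply, inner_smul_right, inner_kick_right ħ p,
      ← inner_conj_symm ψ, mul_comm, Complex.mul_conj, Complex.normSq_eq_norm_sq,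
      Complex.ofReal_re]
  have h1 := inner_dephase_self (ħ := ħ) (μ := μ) hρ.isPositive htr φ
  rw [hT, inner_self_eq_norm_sq_to_K, hφ] at h1
  simp_rw [hin] at h1
  have h2 : ∫ p, ‖⟪φ, kick ħ p ψ⟫_ℂ‖ ^ 2 ∂μ = 1 := by
    have h3 := congrArg Complex.re h1
    rw [Complex.ofReal_re] at h3
    rw [← h3]
    simp
  have hle : ∀ p, ‖⟪φ, kick ħ p ψ⟫_ℂ‖ ≤ 1 := fun p => by
    have := norm_inner_le_norm (𝕜 := ℂ) φ (kick ħ p ψ)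
    rwa [norm_kick_apply, hφ, hn, one_mul] at this
  have hle2 : ∀ p, ‖⟪φ, kick ħ p ψ⟫_ℂ‖ ^ 2 ≤ 1 := fun p => pow_le_one₀ (norm_nonneg _) (hle p)
  have hint : Integrable (fun p => ‖⟪φ, kick ħ p ψ⟫_ℂ‖ ^ 2) μ :=
    Integrable.of_bound ((continuous_inner_kick ħ φ ψ).norm.pow 2).aestronglyMeasurable 1
      (Filter.Eventually.of_forall fun p => by
        rw [Real.norm_of_nonneg (by positivity)]; exact hle2 p)
  -- The average of a quantity bounded by `1` equals `1`, so Cauchy-Schwarz is an equality for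
  -- `μ`-almost every `p`.
  have h4 : ∫ p, (1 - ‖⟪φ, kick ħ p ψ⟫_ℂ‖ ^ 2) ∂μ = 0 := by
    rw [integral_sub (integrable_const _) hint, h2]
    simp
  rw [integral_eq_zero_iff_of_nonneg (fun p => sub_nonneg.mpr (hle2 p))
    ((integrable_const _).sub hint)] at h4
  have h5 : ∀ᵐ p ∂μ, ∃ c : ℂ, c ≠ 0 ∧ kick ħ p ψ = c • φ := by
    filter_upwards [h4] with p hp
    have hp1 : ‖⟪φ, kick ħ p ψ⟫_ℂ‖ = 1 := by
      have : ‖⟪φ, kick ħ p ψ⟫_ℂ‖ ^ 2 = 1 := by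
        have h6 : 1 - ‖⟪φ, kick ħ p ψ⟫_ℂ‖ ^ 2 = 0 := hp
        linarith
      exact (pow_eq_one_iff_of_nonneg (norm_nonneg _) two_ne_zero).mp this
    have hk : ‖kick ħ p ψ‖ = 1 := by rw [norm_kick_apply, hn]
    exact (norm_inner_eq_norm_iff (norm_ne_zero_iff.mp (by rw [hφ]; exact one_ne_zero))
      (norm_ne_zero_iff.mp (by rw [hk]; exact one_ne_zero))).mp (by rw [hp1, hφ, hk, one_mul])
  obtain ⟨q, c, hc, hq⟩ := h5.exists
  -- Kicks proportional to `φ` are proportional to one another, so `μ` is concentrated at `q`.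
  have h6 : ∀ᵐ p ∂μ, p = q := by
    filter_upwards [h5] with p hp'
    obtain ⟨d, _, hp⟩ := hp'
    refine eq_of_kick_eq_smul_kick hħ hψ (c := d * c⁻¹) ?_
    rw [hq, hp, smul_smul, mul_assoc, inv_mul_cancel₀ hc, mul_one]
  obtain ⟨ξ, hξ⟩ := hμ
  have h7 : dephasingFun ħ μ ξ = phase ħ q ξ := by
    rw [dephasingFun, integral_congr_ae (g := fun _ => phase ħ q ξ)
      (by filter_upwards [h6] with p hp; rw [hp])]
    simp
  rw [h7, norm_phase] at hξ
  exact lt_irrefl _ hξ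

end Purity

end Dephasing

end

open Dephasing
theorem mainTheorem7 (ħ : ℝ) (hħ : 0 < ħ) (μA μB : Measure ℝ)
    [IsProbabilityMeasure μA] [IsProbabilityMeasure μB] :
    (∀ ρA ρB : L2R →L[ℂ] L2R, IsDensityOperator ρA → IsDensityOperator ρB →
      (IsDensityOperator (opTensor ρA ρB) ∧
        IsDensityOperator (dephase ħ μA ρA) ∧ IsDensityOperator (dephase ħ μB ρB) ∧
        dephaseProd ħ μA μB (opTensor ρA ρB) =
          opTensor (dephase ħ μA ρA) (dephase ħ μB ρB)) ∧
      relEntropyLoss (dephaseProd ħ μA μB) (opTensor ρA ρB) =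
        relEntropyLoss (dephase ħ μA) ρA + relEntropyLoss (dephase ħ μB) ρB ∧
      hilbertSchmidtLoss (dephaseProd ħ μA μB) (opTensor ρA ρB) =
        purity ρA * purity ρB - purity (dephase ħ μA ρA) * purity (dephase ħ μB ρB)) ∧
    ((∃ ξ, ‖dephasingFun ħ μA ξ‖ < 1) → (∃ ξ, ‖dephasingFun ħ μB ξ‖ < 1) →
      ∃ ρA ρB : L2R →L[ℂ] L2R, IsDensityOperator ρA ∧ IsDensityOperator ρB ∧
        hilbertSchmidtLoss (dephaseProd ħ μA μB) (opTensor ρA ρB) ≠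
          hilbertSchmidtLoss (dephase ħ μA) ρA + hilbertSchmidtLoss (dephase ħ μB) ρB) := by
  have hloss : ∀ ρA ρB : L2R →L[ℂ] L2R, IsDensityOperator ρA → IsDensityOperator ρB →
      hilbertSchmidtLoss (dephaseProd ħ μA μB) (opTensor ρA ρB) =
        purity ρA * purity ρB - purity (dephase ħ μA ρA) * purity (dephase ħ μB ρB) := by
    intro ρA ρB hA hB
    rw [hilbertSchmidtLoss, dephaseProd_opTensor hA hB,
      purity_opTensor hA.isPositive hB.isPositive,
      purity_opTensor (hA.dephase).isPositive (hB.dephase).isPositive]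
  refine ⟨fun ρA ρB hA hB => ⟨⟨hA.opTensor hB, hA.dephase, hB.dephase,
    dephaseProd_opTensor hA hB⟩, ?_, hloss ρA ρB hA hB⟩, fun hgA hgB => ?_⟩
  · rw [relEntropyLoss, dephaseProd_opTensor hA hB,
      relEntropy_opTensor hA hA.dephase hB hB.dephase, relEntropyLoss, relEntropyLoss]
  · obtain ⟨ψ, hn, hψ⟩ := exists_unit_ae_ne_zero
    have hρ := isDensityOperator_rankOne_self hn
    refine ⟨_, _, hρ, hρ, fun h => ?_⟩
    rw [hloss _ _ hρ hρ, hilbertSchmidtLoss, hilbertSchmidtLoss, purity_rankOne_self hn] at h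
    have hA := purity_dephase_ne_one hħ hgA hn hψ
    have hB := purity_dephase_ne_one hħ hgB hn hψ
    -- Additivity would read `1 - ab = (1 - a) + (1 - b)`, that is `(a - 1)(b - 1) = 0`.
    exact mul_ne_zero (sub_ne_zero.mpr hA) (sub_ne_zero.mpr hB) (by linear_combination -h)
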